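/- Let $\mathbb A$ be a finite set with $n$ elements and let $\mathbb S_n$ be the simplex of probability vectors on $\mathbb A$, with the topology inherited from $\mathbb R^n$. Let $\mathcal M_s(\mathbb A^2)$ be the set of stationary distributions on $\mathbb A^2$, i.e. probability distributions $\nu=(\nu_{ij})$ on $\mathbb A^2$ with $\sum_j\nu_{ij}=\sum_j\nu_{ji}$ for all $i\in\mathbb A$; put $\bar\nu_i:=\sum_j\nu_{ij}$. For probability vectors let $D(\nu\Vert\mu):=\sum_i\nu_i\log(\nu_i/\mu_i)$ (with $0\log 0=0$, and $D=+\infty$ if $\mu_i=0<\nu_i$ for some $i$). For strictly positive $\mu\in\mathcal M_s(\mathbb A^2)$ and $\nu\in\mathcal M_s(\mathbb A^2)$ let $D_c(\nu\Vert\mu):=D(\nu\Vert\mu)-D(\bar\nu\Vert\bar\mu)$. **Theorem.** Let $\{X_t\}_{t\ge 0}$ be a stationary Markov chain with values in $\mathbb A$ and doublet frequencies $\mu_{ij}=\Pr\{X_t=i,\ X_{t+1}=j\}$, and suppose that $\mu_{ij}>0$ for all $i,j\in\mathbb A$. For a sample path let $$\phi_j(x_1^l):=\frac1l\sum_{t=1}^l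 I_{\{x_t=j\}},\qquad j\in\mathbb A,\ l\ge1 .$$ Then the $\mathbb S_n$-valued process $\{\phi(x_1^l)\}_{l\ge1}$ satisfies the large deviation property with the lower semicontinuous rate function $J:\mathbb S_n\to\mathbb R\cup\{\infty\}$, $$J(\phi):=\inf\{D_c(\nu\Vert\mu):\ \nu\in\mathcal M_s(\mathbb A^2),\ \bar\nu=\phi\}.$$ That is, $J$ is lower semicontinuous; for every relatively open $\Gamma\subseteq\mathbb S_n$, $$-\inf_{\phi\in\Gamma}J(\phi)\le\liminf_{l\to\infty}\frac1l\log\Pr\{\phi(X_1^l)\in\Gamma\};$$ and for every closed $\Gamma\subseteq\mathbb S_n$, $$\limsup_{l\to\infty}\frac1l\log\Pr\{\phi(X_1^l)\in\Gamma\}\le-\inf_{\phi\in\Gamma}J(\phi)$$ (with $\log 0=-\infty$ and $\inf\emptyset=+\infty$). -/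

import Mathlib

open MeasureTheory Filter
open scoped ENNReal

namespace MarkovLDP

/-- `X 0, X 1, X 2, …` is a stationary Markov chain in the finite alphabet `A`, on the probability
space `(Ω, P)`, with doublet frequencies `μ (i, j) = Pr {X_t = i, X_{t+1} = j}` for every `t`.
(Given the Markov property, stationarity is the same as these frequencies not depending on `t`.)
The Markov property is stated only for histories of nonzero probability. -/
structure IsStationaryMarkovChain {Ω A : Type*} [MeasurableSpace Ω] [MeasurableSpace A]
    (P : Measure Ω) (X : ℕ → Ω → A) (μ : A × A → ℝ) : Prop where
  measurable : ∀ t, Measurable (X t)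
  doublet : ∀ t i j, P {ω | X t ω = i ∧ X (t + 1) ω = j} = ENNReal.ofReal (μ (i, j))
  markov : ∀ (t : ℕ) (x : ℕ → A), P {ω | ∀ s ≤ t, X s ω = x s} ≠ 0 →
    ProbabilityTheory.cond P {ω | ∀ s ≤ t, X s ω = x s} {ω | X (t + 1) ω = x (t + 1)} =
      ProbabilityTheory.cond P {ω | X t ω = x t} {ω | X (t + 1) ω = x (t + 1)}

section

variable {A : Type*} [Fintype A]

/-- The set `M_s(A²)` of stationary distributions on `A²`. -/
def stationaryDist (A : Type*) [Fintype A] : Set (A × A → ℝ) :=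
  {ν | ν ∈ stdSimplex ℝ (A × A) ∧ ∀ i, ∑ j, ν (i, j) = ∑ j, ν (j, i)}

/-- The reduced distribution `ν̄` on `A` of a distribution `ν` on `A²`. -/
def marginal (ν : A × A → ℝ) : A → ℝ := fun i => ∑ j, ν (i, j)

open Classical in
/-- Relative entropy `D(ν ‖ μ) = ∑ ν_i log (ν_i / μ_i)` of probability vectors,
with `0 log 0 = 0`, and `+∞` if `μ_i = 0 < ν_i` for some `i`. -/
noncomputable def relEntropy {B : Type*} [Fintype B] (ν μ : B → ℝ) : EReal :=
  if ∀ i, μ i = 0 → ν i = 0 then ((∑ i, ν i * Real.log (ν i / μ i) : ℝ) : EReal) else ⊤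

/-- Conditional relative entropy `D_c(ν ‖ μ) = D(ν ‖ μ) - D(ν̄ ‖ μ̄)` for strictly positive `μ`
(so that both terms are finite). -/
noncomputable def condRelEntropy (ν μ : A × A → ℝ) : EReal :=
  relEntropy ν μ - relEntropy (marginal ν) (marginal μ)

/-- `J(φ) = inf {D_c(ν ‖ μ) : ν ∈ M_s(A²), ν̄ = φ}`. -/
noncomputable def singletonRate (μ : A × A → ℝ) (φ : stdSimplex ℝ A) : EReal :=
  ⨅ ν ∈ {ν | ν ∈ stationaryDist A ∧ marginal ν = φ}, condRelEntropy ν μ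

end

/-- Empirical frequencies `φ_j(x_1^l) = (1/l) ∑_{t=1}^l I{x_t = j}`. -/
noncomputable def empiricalFreq {A : Type*} [DecidableEq A] (l : ℕ) (x : ℕ → A) : A → ℝ :=
  fun j => (1 / (l : ℝ)) * ∑ t ∈ Finset.Icc 1 l, if x t = j then 1 else 0

/-- For `l ≥ 1` the empirical frequencies form a point of the simplex. -/
theorem empiricalFreq_mem_stdSimplex {A : Type*} [Fintype A] [DecidableEq A] {l : ℕ} (hl : 1 ≤ l)
    (x : ℕ → A) : empiricalFreq l x ∈ stdSimplex ℝ A := by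
  refine ⟨fun j => ?_, ?_⟩
  · unfold empiricalFreq
    exact mul_nonneg (by positivity) (Finset.sum_nonneg fun t _ => by split_ifs <;> norm_num)
  · unfold empiricalFreq
    rw [← Finset.mul_sum, Finset.sum_comm]
    have h : (l : ℝ) ≠ 0 := by positivity
    simp [h]

/-- The large deviation property for a process `Z 1, Z 2, …` with values in `S ⊆ E`, with rate
function `I : S → ℝ ∪ {∞}`; `Γ` runs over the relatively open, respectively closed, subsets of `S`,
and `log 0 = -∞`. -/
structure HasLDP {Ω E : Type*} [MeasurableSpace Ω] [TopologicalSpace E] (P : Measure Ω)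
    (S : Set E) (Z : ℕ → Ω → E) (I : S → EReal) : Prop where
  ne_bot : ∀ s, I s ≠ ⊥
  lower : ∀ Γ : Set S, IsOpen Γ →
    -(⨅ s ∈ Γ, I s) ≤ liminf (fun l : ℕ => ENNReal.log (P {ω | Z l ω ∈ Subtype.val '' Γ}) / l) atTop
  upper : ∀ Γ : Set S, IsClosed Γ →
    limsup (fun l : ℕ => ENNReal.log (P {ω | Z l ω ∈ Subtype.val '' Γ}) / l) atTop ≤ -(⨅ s ∈ Γ, I s)

end MarkovLDP

/-! The method of types, with a word closed into a cycle. Its cyclic doublet frequencies `ν` are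
exactly stationary, and `ν̄` is exactly the vector of letter frequencies. Up to constant factors, a
word has probability `exp (l ∑ ν log (trans μ))` (`exists_pathProb_bounds`). Upper bound
(`exists_sum_pathProb_le`): the words of one type `ν` have bounded total weight under the
transitions of `ν` itself, so their probability is at most a constant times `exp (-l D_c(ν ‖ μ))`;
there are only polynomially many types. Lower bound (`exists_eventually_le_sum_pathProb`): perturb
`ν` to a strictly positive `ρ` and change measure from `μ` to `ρ`. The required law of large numbers
for `ρ` is the upper bound applied to `ρ`, since `D_c(· ‖ ρ)` vanishes only at `ρ` and is therefore
bounded below off any neighbourhood of it. Lower semicontinuity follows from compactness of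
`M_s(A²)`. -/

namespace MarkovLDP

/-! ### Path weights and cyclic doublet types -/

section Paths

variable {A : Type*}

/-- Weight of a path under the transition weights `q`. -/
def pathWeight (q : A × A → ℝ) {m : ℕ} (x : Fin (m + 1) → A) : ℝ :=
  ∏ t : Fin m, q (x t.castSucc, x t.succ)

theorem pathWeight_nonneg {q : A × A → ℝ} (hq : ∀ p, 0 ≤ q p) {m : ℕ} (x : Fin (m + 1) → A) :
    0 ≤ pathWeight q x :=
  Finset.prod_nonneg fun _ _ => hq _

theorem prod_cyclic_eq (q : A × A → ℝ) {m : ℕ} (x : Fin (m + 1) → A) :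
    ∏ t, q (x t, x (t + 1)) = pathWeight q x * q (x (Fin.last m), x 0) := by
  rw [Fin.prod_univ_castSucc]
  simp [pathWeight]

theorem pathWeight_cons (q : A × A → ℝ) {m : ℕ} (a : A) (x : Fin (m + 1) → A) :
    pathWeight q (Fin.cons a x : Fin (m + 2) → A) = q (a, x 0) * pathWeight q x := by
  rw [pathWeight, Fin.prod_univ_succ]
  simp [pathWeight]

section

variable [DecidableEq A]

/-- Number of cyclically consecutive occurrences of a pair of letters in a word. -/
def cyclicCount {m : ℕ} (x : Fin (m + 1) → A) (p : A × A) : ℕ :=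
  (Finset.univ.filter fun t => (x t, x (t + 1)) = p).card

theorem cyclicCount_lt {m : ℕ} (x : Fin (m + 1) → A) (p : A × A) :
    cyclicCount x p < m + 2 := by
  have := Finset.card_filter_le Finset.univ fun t => (x t, x (t + 1)) = p
  simp only [Finset.card_univ, Fintype.card_fin] at this
  unfold cyclicCount
  omega

/-- Cyclic doublet frequencies of a word. -/
noncomputable def cyclicFreq {m : ℕ} (x : Fin (m + 1) → A) (p : A × A) : ℝ :=
  cyclicCount x p / ((m + 1 : ℕ) : ℝ)

theorem cyclicFreq_pos {m : ℕ} (x : Fin (m + 1) → A) (t : Fin (m + 1)) :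
    0 < cyclicFreq x (x t, x (t + 1)) := by
  refine div_pos (Nat.cast_pos.2 (Finset.card_pos.2 ⟨t, by simp⟩)) (by positivity)

end

variable [Fintype A]

theorem sum_cons_eq {m : ℕ} (F : (Fin (m + 2) → A) → ℝ) :
    ∑ x, F x = ∑ a, ∑ y : Fin (m + 1) → A, F (Fin.cons a y) := by
  rw [← (Fin.consEquiv (fun _ : Fin (m + 2) => A)).sum_comp, Fintype.sum_prod_type]
  rfl

theorem sum_pathWeight_eq {q : A × A → ℝ} (hq : ∀ i, ∑ j, q (i, j) = 1) {m : ℕ} (f : A → ℝ) :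
    ∑ x : Fin (m + 1) → A, f (x 0) * pathWeight q x = ∑ a, f a := by
  induction m generalizing f with
  | zero =>
    rw [← (Equiv.funUnique (Fin 1) A).symm.sum_comp]
    simp [pathWeight]
  | succ m ih =>
    rw [sum_cons_eq]
    refine Finset.sum_congr rfl fun a _ => ?_
    simp only [pathWeight_cons, Fin.cons_zero]
    rw [← Finset.mul_sum, ih fun b => q (a, b), hq, mul_one]

/-- The substochastic case is needed for `trans ν`, whose rows vanish at letters of zero marginal.
-/
theorem sum_pathWeight_le {q : A × A → ℝ} (hq : ∀ i, ∑ j, q (i, j) ≤ 1) {m : ℕ} (f : A → ℝ)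
    (hf : ∀ a, 0 ≤ f a) (hq0 : ∀ p, 0 ≤ q p) :
    ∑ x : Fin (m + 1) → A, f (x 0) * pathWeight q x ≤ ∑ a, f a := by
  induction m generalizing f with
  | zero =>
    rw [← (Equiv.funUnique (Fin 1) A).symm.sum_comp]
    simp [pathWeight]
  | succ m ih =>
    rw [sum_cons_eq]
    refine Finset.sum_le_sum fun a _ => ?_
    simp only [pathWeight_cons, Fin.cons_zero]
    rw [← Finset.mul_sum]
    exact mul_le_of_le_one_right (hf a) ((ih (fun b => q (a, b)) fun b => hq0 _).trans (hq a))

variable [DecidableEq A]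

theorem sum_cyclicFreq_mul {m : ℕ} (x : Fin (m + 1) → A) (g : A × A → ℝ) :
    ((m + 1 : ℕ) : ℝ) * ∑ p, cyclicFreq x p * g p = ∑ t, g (x t, x (t + 1)) := by
  have h : ((m + 1 : ℕ) : ℝ) ≠ 0 := by positivity
  rw [Finset.mul_sum, ← Finset.sum_fiberwise Finset.univ fun t => (x t, x (t + 1))]
  refine Finset.sum_congr rfl fun p _ => ?_
  rw [Finset.sum_congr rfl (g := fun _ => g p) (by simp +contextual), Finset.sum_const,
    nsmul_eq_mul, cyclicFreq, cyclicCount]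
  field_simp

theorem marginal_cyclicFreq {m : ℕ} (x : Fin (m + 1) → A) (i : A) :
    ((m + 1 : ℕ) : ℝ) * marginal (cyclicFreq x) i = ∑ t, if x t = i then 1 else 0 := by
  have := sum_cyclicFreq_mul x fun p => if p.1 = i then 1 else 0
  rw [← this, Fintype.sum_prod_type]
  simp [marginal, Finset.sum_ite_irrel]

/-- The cyclic shift permutes the positions, so each letter occurs equally often as first and as
second member of a pair. -/
theorem cyclicFreq_mem {m : ℕ} (x : Fin (m + 1) → A) : cyclicFreq x ∈ stationaryDist A := by
  have h : ((m + 1 : ℕ) : ℝ) ≠ 0 := by positivity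
  refine ⟨⟨fun p => by unfold cyclicFreq; positivity, ?_⟩, fun i => ?_⟩
  · have := sum_cyclicFreq_mul x fun _ => 1
    simp only [mul_one, Finset.sum_const, Finset.card_univ, Fintype.card_fin, nsmul_eq_mul] at this
    exact mul_left_cancel₀ h (this.trans (mul_one _).symm)
  · refine mul_left_cancel₀ h ((marginal_cyclicFreq x i).trans ?_)
    have := sum_cyclicFreq_mul x fun p => if p.2 = i then 1 else 0
    rw [Fintype.sum_prod_type, Finset.sum_comm] at this
    simp only [mul_ite, mul_one, mul_zero, Finset.sum_ite_irrel, Finset.sum_const_zero,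
      Finset.sum_ite_eq', Finset.mem_univ, if_true] at this
    rw [this]
    exact (Equiv.sum_comp (Equiv.addRight (1 : Fin (m + 1))) fun t => if x t = i then 1 else 0).symm

theorem prod_cyclic_eq_exp {m : ℕ} (x : Fin (m + 1) → A) {q : A × A → ℝ}
    (hq : ∀ t, 0 < q (x t, x (t + 1))) :
    ∏ t, q (x t, x (t + 1)) =
      Real.exp (((m + 1 : ℕ) : ℝ) * ∑ p, cyclicFreq x p * Real.log (q p)) := by
  rw [sum_cyclicFreq_mul x fun p => Real.log (q p), Real.exp_sum]
  exact Finset.prod_congr rfl fun t _ => (Real.exp_log (hq t)).symm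

end Paths

/-! ### Conditional relative entropy: continuity, positivity, uniqueness of the zero -/

section Entropy

variable {A : Type*} [Fintype A]

/-- Transition weights of a distribution on `A²`. -/
noncomputable def trans (ν : A × A → ℝ) (p : A × A) : ℝ := ν p / marginal ν p.1

/-- Real-valued conditional relative entropy, written with the transition weights. -/
noncomputable def condKL (ν μ : A × A → ℝ) : ℝ :=
  ∑ p, ν p * (Real.log (trans ν p) - Real.log (trans μ p))

theorem le_marginal {ν : A × A → ℝ} (h : ∀ p, 0 ≤ ν p) (p : A × A) : ν p ≤ marginal ν p.1 :=
  Finset.single_le_sum (f := fun j => ν (p.1, j)) (fun _ _ => h _) (Finset.mem_univ p.2)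

theorem marginal_nonneg {ν : A × A → ℝ} (h : ∀ p, 0 ≤ ν p) (i : A) : 0 ≤ marginal ν i :=
  Finset.sum_nonneg fun _ _ => h _

theorem sum_marginal (ν : A × A → ℝ) : ∑ i, marginal ν i = ∑ p, ν p :=
  (Fintype.sum_prod_type ν).symm

theorem sum_marginal_mul (ν : A × A → ℝ) (f : A → ℝ) :
    ∑ i, marginal ν i * f i = ∑ p, ν p * f p.1 := by
  rw [Fintype.sum_prod_type]
  simp [marginal, Finset.sum_mul]

theorem trans_nonneg {ν : A × A → ℝ} (h : ∀ p, 0 ≤ ν p) (p : A × A) : 0 ≤ trans ν p :=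
  div_nonneg (h p) (marginal_nonneg h _)

theorem trans_pos {ν : A × A → ℝ} (h : ∀ p, 0 ≤ ν p) {p : A × A} (hp : 0 < ν p) :
    0 < trans ν p :=
  div_pos hp (hp.trans_le (le_marginal h p))

theorem trans_le_one {ν : A × A → ℝ} (h : ∀ p, 0 ≤ ν p) (p : A × A) : trans ν p ≤ 1 :=
  div_le_one_of_le₀ (le_marginal h p) (marginal_nonneg h _)

theorem sum_trans (ν : A × A → ℝ) (i : A) :
    ∑ j, trans ν (i, j) = marginal ν i / marginal ν i := by
  simp only [trans, ← Finset.sum_div]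
  rfl

theorem marginal_mul_trans {ν : A × A → ℝ} (h : ∀ p, 0 ≤ ν p) (p : A × A) :
    marginal ν p.1 * trans ν p = ν p := by
  rcases (h p).eq_or_lt with hp | hp
  · simp [trans, ← hp]
  · have := hp.trans_le (le_marginal h p)
    rw [trans]
    field_simp

theorem marginal_mem_stdSimplex {ν : A × A → ℝ} (h : ν ∈ stationaryDist A) :
    marginal ν ∈ stdSimplex ℝ A :=
  ⟨marginal_nonneg h.1.1, (sum_marginal ν).trans h.1.2⟩

theorem marginal_le_one {ν : A × A → ℝ} (h : ν ∈ stationaryDist A) (i : A) :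
    marginal ν i ≤ 1 := by
  have := marginal_mem_stdSimplex h
  rw [← this.2]
  exact Finset.single_le_sum (fun j _ => this.1 j) (Finset.mem_univ i)

theorem continuous_marginal : Continuous (marginal : (A × A → ℝ) → A → ℝ) := by
  unfold marginal
  fun_prop

/-- In this form `ν` enters only linearly and through `t log t`, which is continuous at `0`. -/
theorem condKL_eq {ν : A × A → ℝ} (μ : A × A → ℝ) (h : ∀ p, 0 ≤ ν p) :
    condKL ν μ = ∑ p, (ν p * Real.log (ν p) - ν p * Real.log (trans μ p)) -
      ∑ i, marginal ν i * Real.log (marginal ν i) := by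
  rw [sum_marginal_mul, ← Finset.sum_sub_distrib]
  refine Finset.sum_congr rfl fun p _ => ?_
  rcases (h p).eq_or_lt with hp | hp
  · simp [← hp]
  · rw [trans, Real.log_div hp.ne' (hp.trans_le (le_marginal h p)).ne']
    ring

theorem continuousOn_condKL (μ : A × A → ℝ) :
    ContinuousOn (fun ν => condKL ν μ) {ν | ∀ p, 0 ≤ ν p} := by
  have : Continuous fun ν : A × A → ℝ =>
      ∑ p, (ν p * Real.log (ν p) - ν p * Real.log (trans μ p)) -
        ∑ i, marginal ν i * Real.log (marginal ν i) := by
    refine .sub (continuous_finsetSum _ fun p _ => .sub ?_ (by fun_prop))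
      (continuous_finsetSum _ fun i _ => ?_)
    · exact Real.continuous_mul_log.comp (continuous_apply p)
    · exact Real.continuous_mul_log.comp ((continuous_apply i).comp continuous_marginal)
  exact this.continuousOn.congr fun ν hν => condKL_eq μ hν

theorem condRelEntropy_eq_condKL {ν μ : A × A → ℝ} (h : ∀ p, 0 ≤ ν p) (hμ : ∀ p, 0 < μ p) :
    condRelEntropy ν μ = condKL ν μ := by
  have hm (p : A × A) : 0 < marginal μ p.1 := (hμ p).trans_le (le_marginal (fun p => (hμ p).le) p)
  rw [condRelEntropy, relEntropy, relEntropy, if_pos fun p hp => absurd hp (hμ p).ne',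
    if_pos, ← EReal.coe_sub, sum_marginal_mul _ fun i => Real.log (marginal ν i / marginal μ i),
    ← Finset.sum_sub_distrib, condKL]
  · refine congrArg _ (Finset.sum_congr rfl fun p _ => ?_)
    rcases (h p).eq_or_lt with hp | hp
    · simp [← hp]
    · have h1 := (hp.trans_le (le_marginal h p)).ne'
      rw [trans, trans, Real.log_div hp.ne' h1, Real.log_div hp.ne' (hμ p).ne',
        Real.log_div h1 (hm p).ne', Real.log_div (hμ p).ne' (hm p).ne']
      ring
  · intro i hi
    exact absurd hi (hm (i, i)).ne'

theorem isCompact_stationaryDist : IsCompact (stationaryDist A) := by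
  have : IsClosed {ν : A × A → ℝ | ∀ i, ∑ j, ν (i, j) = ∑ j, ν (j, i)} := by
    simp only [Set.ofPred_forall]
    exact isClosed_iInter fun i => isClosed_eq (by fun_prop) (by fun_prop)
  exact (isCompact_stdSimplex ℝ (A × A)).inter_right this

theorem nonempty_of_mem_stationaryDist {ν : A × A → ℝ} (h : ν ∈ stationaryDist A) :
    Nonempty A := by
  by_contra hA
  rw [not_nonempty_iff] at hA
  simpa using h.1.2

theorem exists_pos_le {μ : A × A → ℝ} (hμ : μ ∈ stationaryDist A) (hpos : ∀ p, 0 < μ p) :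
    ∃ c > 0, ∀ p, c ≤ μ p := by
  have := nonempty_of_mem_stationaryDist hμ
  obtain ⟨p, hp⟩ := Finite.exists_min μ
  exact ⟨μ p, hpos p, hp⟩

theorem le_trans_self {μ : A × A → ℝ} (hμ : μ ∈ stationaryDist A) (p : A × A) :
    μ p ≤ trans μ p := by
  conv_lhs => rw [← marginal_mul_trans hμ.1.1 p]
  exact mul_le_of_le_one_left (trans_nonneg hμ.1.1 p) (marginal_le_one hμ _)

theorem sum_trans_eq_one {μ : A × A → ℝ} (hpos : ∀ p, 0 < μ p) (i : A) :
    ∑ j, trans μ (i, j) = 1 := by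
  rw [sum_trans, div_self]
  exact ((hpos (i, i)).trans_le (le_marginal (fun p => (hpos p).le) (i, i))).ne'

-- The correction terms in `klFun` cancel because `ν` and `ν̄ ⊗ trans μ` both have total mass `1`;
-- what results is a sum of nonnegative terms.
open InformationTheory in
theorem condKL_eq_sum_klFun {ν μ : A × A → ℝ} (h : ν ∈ stationaryDist A) (hpos : ∀ p, 0 < μ p) :
    condKL ν μ = ∑ p : A × A, marginal ν p.1 * trans μ p *
      klFun (ν p / (marginal ν p.1 * trans μ p)) := by
  have key : ∑ p : A × A, (marginal ν p.1 * trans μ p - ν p) = 0 := by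
    rw [Finset.sum_sub_distrib, h.1.2, Fintype.sum_prod_type]
    simp_rw [← Finset.mul_sum, sum_trans_eq_one hpos, mul_one]
    rw [(marginal_mem_stdSimplex h).2, sub_self]
  rw [← add_zero (condKL ν μ), ← key, condKL, ← Finset.sum_add_distrib]
  refine Finset.sum_congr rfl fun p _ => ?_
  have hb := trans_pos (fun p => (hpos p).le) (hpos p)
  rcases (h.1.1 p).eq_or_lt with hp | hp
  · simp [← hp, klFun]
  · have h1 := hp.trans_le (le_marginal h.1.1 p)
    rw [klFun, trans, Real.log_div hp.ne' h1.ne', Real.log_div hp.ne' (mul_pos h1 hb).ne',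
      Real.log_mul h1.ne' hb.ne']
    field_simp
    ring

theorem condKL_nonneg {ν μ : A × A → ℝ} (h : ν ∈ stationaryDist A) (hpos : ∀ p, 0 < μ p) :
    0 ≤ condKL ν μ := by
  rw [condKL_eq_sum_klFun h hpos]
  have h1 (p : A × A) : 0 ≤ marginal ν p.1 * trans μ p :=
    mul_nonneg (marginal_nonneg h.1.1 _) (trans_nonneg (fun p => (hpos p).le) _)
  exact Finset.sum_nonneg fun p _ =>
    mul_nonneg (h1 p) (InformationTheory.klFun_nonneg (div_nonneg (h.1.1 p) (h1 p)))

/-- Doeblin contraction: as `d` has sum zero, subtracting the least entry of `q` from every entry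
does not change `d q`, and the reduced matrix contracts the `ℓ¹` norm strictly. -/
theorem eq_zero_of_vecMul_eq_self {q : A × A → ℝ} (hpos : ∀ p, 0 < q p)
    (hq : ∀ i, ∑ j, q (i, j) = 1) {d : A → ℝ} (hd : ∑ i, d i = 0)
    (h : ∀ j, ∑ i, d i * q (i, j) = d j) (i : A) : d i = 0 := by
  have : Nonempty A := ⟨i⟩
  obtain ⟨p, hp⟩ := Finite.exists_min q
  have h1 (j : A) : |d j| ≤ ∑ i, |d i| * (q (i, j) - q p) := by
    calc |d j| = |∑ i, d i * (q (i, j) - q p)| := by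
          simp_rw [mul_sub, Finset.sum_sub_distrib, ← Finset.sum_mul, hd, h, zero_mul, sub_zero]
      _ ≤ ∑ i, |d i * (q (i, j) - q p)| := Finset.abs_sum_le_sum_abs _ _
      _ = _ := Finset.sum_congr rfl fun i _ => by
          rw [abs_mul, abs_of_nonneg (sub_nonneg.2 (hp (i, j)))]
  have h2 : ∑ j, |d j| ≤ (∑ i, |d i|) * (1 - Fintype.card A * q p) := by
    refine (Finset.sum_le_sum fun j _ => h1 j).trans_eq ?_
    rw [Finset.sum_comm, Finset.sum_mul]
    refine Finset.sum_congr rfl fun i _ => ?_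
    rw [← Finset.mul_sum, Finset.sum_sub_distrib, hq]
    simp
  have h3 : 0 < Fintype.card A * q p := mul_pos (by exact_mod_cast Fintype.card_pos) (hpos p)
  have h4 : ∑ j, |d j| ≤ 0 := by nlinarith
  exact abs_nonpos_iff.1
    ((Finset.single_le_sum (fun j _ => abs_nonneg (d j)) (Finset.mem_univ i)).trans h4)

/-- Vanishing of every `klFun` term gives `ν` the transitions of `μ`; both marginals are then
invariant under one positive kernel, so they agree. -/
theorem eq_of_condKL_eq_zero {ν μ : A × A → ℝ} (h : ν ∈ stationaryDist A)
    (hμ : μ ∈ stationaryDist A) (hpos : ∀ p, 0 < μ p) (h0 : condKL ν μ = 0) : ν = μ := by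
  have hb (p) := trans_pos (fun p => (hpos p).le) (hpos p)
  have hν (p : A × A) : ν p = marginal ν p.1 * trans μ p := by
    rcases (marginal_nonneg h.1.1 p.1).eq_or_lt with hp | hp
    · rw [← hp, zero_mul]
      exact le_antisymm ((le_marginal h.1.1 p).trans hp.ge) (h.1.1 p)
    have h1 (p : A × A) : 0 ≤ marginal ν p.1 * trans μ p :=
      mul_nonneg (marginal_nonneg h.1.1 _) (hb p).le
    rw [condKL_eq_sum_klFun h hpos, Finset.sum_eq_zero_iff_of_nonneg fun p _ =>
      mul_nonneg (h1 p) (InformationTheory.klFun_nonneg (div_nonneg (h.1.1 p) (h1 p)))] at h0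
    have h2 := (mul_eq_zero.1 (h0 p (Finset.mem_univ p))).resolve_left (mul_pos hp (hb p)).ne'
    rw [InformationTheory.klFun_eq_zero_iff (div_nonneg (h.1.1 p) (h1 p))] at h2
    exact (div_eq_one_iff_eq (mul_pos hp (hb p)).ne').1 h2
  have hμ' (p : A × A) : μ p = marginal μ p.1 * trans μ p := (marginal_mul_trans hμ.1.1 p).symm
  have hinv {ρ : A × A → ℝ} (hρ : ρ ∈ stationaryDist A)
      (h : ∀ p : A × A, ρ p = marginal ρ p.1 * trans μ p) (j : A) :
      ∑ i, marginal ρ i * trans μ (i, j) = marginal ρ j := by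
    rw [marginal, hρ.2 j]
    exact Finset.sum_congr rfl fun i _ => (h (i, j)).symm
  have hm (i : A) : marginal ν i - marginal μ i = 0 := by
    refine eq_zero_of_vecMul_eq_self (d := fun i => marginal ν i - marginal μ i) hb
      (sum_trans_eq_one hpos) ?_ (fun j => ?_) i
    · rw [Finset.sum_sub_distrib, (marginal_mem_stdSimplex h).2, (marginal_mem_stdSimplex hμ).2,
        sub_self]
    · simp only [sub_mul, Finset.sum_sub_distrib, hinv h hν, hinv hμ hμ']
  ext p
  rw [hν, hμ' p, sub_eq_zero.1 (hm p.1)]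

end Entropy

/-! ### Path probabilities and the type-class upper bound -/

section PathProb

variable {A : Type*} [Fintype A]

/-- Probability of a path of the stationary Markov chain with doublet frequencies `μ`. -/
noncomputable def pathProb (μ : A × A → ℝ) {m : ℕ} (x : Fin (m + 1) → A) : ℝ :=
  marginal μ (x 0) * pathWeight (trans μ) x

theorem pathProb_nonneg {μ : A × A → ℝ} (h : ∀ p, 0 ≤ μ p) {m : ℕ} (x : Fin (m + 1) → A) :
    0 ≤ pathProb μ x :=
  mul_nonneg (marginal_nonneg h _) (pathWeight_nonneg (trans_nonneg h) _)

theorem sum_pathProb {μ : A × A → ℝ} (hμ : μ ∈ stationaryDist A) (hpos : ∀ p, 0 < μ p) (m : ℕ) :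
    ∑ x : Fin (m + 1) → A, pathProb μ x = 1 :=
  (sum_pathWeight_eq (sum_trans_eq_one hpos) _).trans (marginal_mem_stdSimplex hμ).2

variable [DecidableEq A]

/-- The cyclic product trades the initial probability for the closing transition; both lie between
`c = min μ` and `1`. -/
theorem exists_pathProb_bounds {μ : A × A → ℝ} (hμ : μ ∈ stationaryDist A)
    (hpos : ∀ p, 0 < μ p) : ∃ c > 0, ∀ {m : ℕ} (x : Fin (m + 1) → A),
      c * Real.exp (((m + 1 : ℕ) : ℝ) * ∑ p, cyclicFreq x p * Real.log (trans μ p)) ≤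
        pathProb μ x ∧
      pathProb μ x ≤
        c⁻¹ * Real.exp (((m + 1 : ℕ) : ℝ) * ∑ p, cyclicFreq x p * Real.log (trans μ p)) := by
  obtain ⟨c, hc, hcμ⟩ := exists_pos_le hμ hpos
  refine ⟨c, hc, fun {m} x => ?_⟩
  have hb (p) := trans_pos hμ.1.1 (hpos p)
  have h1 := hcμ (x (Fin.last m), x 0)
  have h2 := le_trans_self hμ (x (Fin.last m), x 0)
  have h3 := trans_le_one hμ.1.1 (x (Fin.last m), x 0)
  have h4 := marginal_le_one hμ (x 0)
  have h5 := (hcμ (x 0, x 0)).trans (le_marginal hμ.1.1 (x 0, x 0))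
  have hw := pathWeight_nonneg (fun p => (hb p).le) x
  rw [← prod_cyclic_eq_exp x fun t => hb _, prod_cyclic_eq, pathProb]
  set w := pathWeight (trans μ) x
  set b := trans μ (x (Fin.last m), x 0)
  simp only at h5
  constructor
  · calc c * (w * b) ≤ c * (w * 1) := by gcongr
      _ ≤ marginal μ (x 0) * w := by rw [mul_one]; gcongr
  · calc marginal μ (x 0) * w ≤ 1 * w := by gcongr
      _ = c⁻¹ * (w * c) := by field_simp
      _ ≤ c⁻¹ * (w * b) := by gcongr; exact h1.trans h2

/-- The upper bound of the method of types, for the cyclic doublet frequencies. -/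
theorem exists_sum_pathProb_le {μ : A × A → ℝ} (hμ : μ ∈ stationaryDist A)
    (hpos : ∀ p, 0 < μ p) : ∃ C > 0, ∀ {m : ℕ} (S : Finset (Fin (m + 1) → A)) (a : ℝ),
      (∀ x ∈ S, a ≤ condKL (cyclicFreq x) μ) →
      ∑ x ∈ S, pathProb μ x ≤
        C * ((m + 2 : ℕ) : ℝ) ^ Fintype.card (A × A) * Real.exp (-((m + 1 : ℕ) * a)) := by
  obtain ⟨c, hc, hcμ⟩ := exists_pathProb_bounds hμ hpos
  have := nonempty_of_mem_stationaryDist hμ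
  have hA : (0 : ℝ) < Fintype.card A := by exact_mod_cast Fintype.card_pos
  refine ⟨c⁻¹ * Fintype.card A, by positivity, fun {m} S a hS => ?_⟩
  -- The vector of counts takes at most `(m + 2) ^ |A × A|` values, which gives the polynomial
  -- factor.
  let κ (x : Fin (m + 1) → A) (p : A × A) : Fin (m + 2) := ⟨cyclicCount x p, cyclicCount_lt x p⟩
  rw [← Finset.sum_fiberwise S κ]
  calc ∑ k, ∑ x ∈ S with κ x = k, pathProb μ x
      ≤ ∑ _k : A × A → Fin (m + 2), c⁻¹ * Fintype.card A * Real.exp (-((m + 1 : ℕ) * a)) := by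
        refine Finset.sum_le_sum fun k _ => ?_
        rcases (S.filter fun x => κ x = k).eq_empty_or_nonempty with h0 | ⟨y, hy⟩
        · rw [h0, Finset.sum_empty]
          positivity
        obtain ⟨hyS, hyk⟩ := Finset.mem_filter.1 hy
        set ν := cyclicFreq y with hν
        have hν0 := (cyclicFreq_mem y).1.1
        -- On one type class the likelihood ratio of `μ` to `ν` is constant, up to bounded factors
        -- `exp (-(m + 1) D_c(ν ‖ μ))`. The factor `1 *` fits the initial weight `f` of
        -- `sum_pathWeight_le`.
        have hx (x) (hx : x ∈ S.filter fun x => κ x = k) : pathProb μ x ≤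
            c⁻¹ * Real.exp (-((m + 1 : ℕ) * a)) * (1 * pathWeight (trans ν) x) := by
          have hxν : cyclicFreq x = ν := by
            ext p
            have := congrArg Fin.val (congrFun ((Finset.mem_filter.1 hx).2.trans hyk.symm) p)
            simp only [κ] at this
            rw [hν, cyclicFreq, cyclicFreq, this]
          have h1 : ∏ t, trans ν (x t, x (t + 1)) =
              Real.exp (((m + 1 : ℕ) : ℝ) * ∑ p, ν p * Real.log (trans ν p)) := by
            rw [← hxν]
            exact prod_cyclic_eq_exp x fun t => trans_pos (cyclicFreq_mem x).1.1 (cyclicFreq_pos x t)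
          have h2 : ∏ t, trans ν (x t, x (t + 1)) ≤ pathWeight (trans ν) x := by
            rw [prod_cyclic_eq]
            exact mul_le_of_le_one_right (pathWeight_nonneg (trans_nonneg hν0) x)
              (trans_le_one hν0 _)
          rw [h1] at h2
          refine ((hcμ x).2).trans ?_
          rw [hxν, one_mul, mul_assoc]
          gcongr
          refine le_trans ?_ (mul_le_mul_of_nonneg_left h2 (Real.exp_nonneg _))
          rw [← Real.exp_add, Real.exp_le_exp]
          have h3 := hS y hyS
          rw [← hν, condKL] at h3
          simp_rw [mul_sub, Finset.sum_sub_distrib] at h3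
          have h4 := mul_le_mul_of_nonneg_left h3 (Nat.cast_nonneg (α := ℝ) (m + 1))
          linarith
        refine (Finset.sum_le_sum hx).trans ?_
        rw [← Finset.mul_sum, mul_right_comm]
        gcongr
        calc ∑ x ∈ S with κ x = k, 1 * pathWeight (trans ν) x
            ≤ ∑ x : Fin (m + 1) → A, 1 * pathWeight (trans ν) x :=
              Finset.sum_le_sum_of_subset_of_nonneg (Finset.subset_univ _) fun x _ _ => by
                rw [one_mul]
                exact pathWeight_nonneg (trans_nonneg hν0) x
          _ ≤ ∑ _a : A, (1 : ℝ) := sum_pathWeight_le (fun i => by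
                rw [sum_trans]
                exact div_self_le_one _) (fun _ => 1) (fun _ => zero_le_one) (trans_nonneg hν0)
          _ = Fintype.card A := by simp
    _ = _ := by
        simp only [Finset.sum_const, Finset.card_univ, Fintype.card_fun, Fintype.card_fin,
          nsmul_eq_mul, Nat.cast_pow]
        ring

end PathProb

/-- Closing the word into a cycle leaves no boundary error in the letter frequencies. -/
theorem empiricalFreq_eq_marginal {A : Type*} [Fintype A] [DecidableEq A] (m : ℕ) (x : ℕ → A) :
    empiricalFreq (m + 1) x = marginal (cyclicFreq fun t : Fin (m + 1) => x (t + 1)) := by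
  ext j
  have h : ((m + 1 : ℕ) : ℝ) ≠ 0 := by positivity
  refine mul_left_cancel₀ h ?_
  rw [marginal_cyclicFreq, empiricalFreq, ← mul_assoc, mul_one_div_cancel h, one_mul,
    ← Finset.Ico_add_one_right_eq_Icc, Finset.sum_Ico_eq_sum_range, Finset.sum_range]
  simp only [add_comm 1]
  rfl

/-! ### Path probabilities of the given chain -/

section Chain

variable {Ω A : Type*} [MeasurableSpace Ω] [Fintype A] [MeasurableSpace A]
  [MeasurableSingletonClass A] {P : Measure Ω} {X : ℕ → Ω → A} {μ : A × A → ℝ}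

theorem IsStationaryMarkovChain.measure_eq_marginal (hX : IsStationaryMarkovChain P X μ)
    (hμ : ∀ p, 0 ≤ μ p) (t : ℕ) (i : A) :
    P {ω | X t ω = i} = ENNReal.ofReal (marginal μ i) := by
  rw [marginal, ENNReal.ofReal_sum_of_nonneg fun j _ => hμ _]
  simp_rw [← hX.doublet t]
  rw [← measure_biUnion_finset]
  · congr 1
    ext ω
    simp
  · intro j _ k _ hjk
    refine Set.disjoint_left.2 fun ω hj hk => hjk ?_
    exact hj.2.symm.trans hk.2
  · intro j _
    exact (hX.measurable t (measurableSet_singleton i)).inter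
      (hX.measurable (t + 1) (measurableSet_singleton j))

/-- Positivity of `μ` gives every history nonzero probability, so the Markov property applies at
each step of the induction. -/
theorem IsStationaryMarkovChain.measure_path (hX : IsStationaryMarkovChain P X μ)
    (hpos : ∀ p, 0 < μ p) (x : ℕ → A) (t : ℕ) :
    P {ω | ∀ s ≤ t, X s ω = x s} =
      ENNReal.ofReal (marginal μ (x 0) * ∏ s ∈ Finset.range t, trans μ (x s, x (s + 1))) := by
  have hb (p) := trans_pos (fun p => (hpos p).le) (hpos p)
  have hm (i : A) : 0 < marginal μ i :=
    (hpos (i, i)).trans_le (le_marginal (fun p => (hpos p).le) (i, i))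
  induction t with
  | zero => simpa using hX.measure_eq_marginal (fun p => (hpos p).le) 0 (x 0)
  | succ t ih =>
    have hw : 0 < marginal μ (x 0) * ∏ s ∈ Finset.range t, trans μ (x s, x (s + 1)) :=
      mul_pos (hm _) (Finset.prod_pos fun s _ => hb _)
    have hH : MeasurableSet {ω | ∀ s ≤ t, X s ω = x s} := by
      simp only [Set.ofPred_forall]
      exact .iInter fun s => .iInter fun _ => hX.measurable s (measurableSet_singleton _)
    have hne : P {ω | ∀ s ≤ t, X s ω = x s} ≠ 0 := by
      rw [ih]
      simpa using hw
    have h1 := hX.markov t x hne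
    have ht : MeasurableSet {ω | X t ω = x t} := hX.measurable t (measurableSet_singleton _)
    rw [ProbabilityTheory.cond_apply hH, ProbabilityTheory.cond_apply ht, hX.measure_eq_marginal fun p => (hpos p).le]
      at h1
    have h2 : {ω | X t ω = x t} ∩ {ω | X (t + 1) ω = x (t + 1)} =
      {ω | X t ω = x t ∧ X (t + 1) ω = x (t + 1)} := rfl
    have h3 : {ω | ∀ s ≤ t, X s ω = x s} ∩ {ω | X (t + 1) ω = x (t + 1)} =
        {ω | ∀ s ≤ t + 1, X s ω = x s} := by
      ext ω
      simp only [Set.mem_inter_iff, Set.mem_ofPred_eq]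
      refine ⟨fun h s hs => ?_, fun h => ⟨fun s hs => h s (by omega), h _ le_rfl⟩⟩
      rcases hs.lt_or_eq with hs | rfl
      · exact h.1 s (by omega)
      · exact h.2
    rw [h2, h3, hX.doublet, ← ENNReal.ofReal_inv_of_pos (hm _),
      ← ENNReal.ofReal_mul (inv_nonneg.2 (hm _).le)] at h1
    have h4 := congrArg (P {ω | ∀ s ≤ t, X s ω = x s} * ·) h1
    rw [← mul_assoc, ENNReal.mul_inv_cancel hne (by rw [ih]; exact ENNReal.ofReal_ne_top), one_mul,
      ih, ← ENNReal.ofReal_mul hw.le] at h4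
    rw [h4, Finset.prod_range_succ, trans]
    congr 1
    ring

theorem IsStationaryMarkovChain.measure_path_succ (hX : IsStationaryMarkovChain P X μ)
    (hμ : μ ∈ stationaryDist A) (hpos : ∀ p, 0 < μ p) {m : ℕ} (x : Fin (m + 1) → A) :
    P {ω | (fun t : Fin (m + 1) => X (t + 1) ω) = x} = ENNReal.ofReal (pathProb μ x) := by
  have hb (p) := trans_pos (fun p => (hpos p).le) (hpos p)
  have hm (i : A) : 0 ≤ marginal μ i := marginal_nonneg (fun p => (hpos p).le) i
  -- The observed word starts at time `1`; `a` stands for `X 0`, which is summed out by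
  -- stationarity. Values beyond `m + 1` are irrelevant.
  let y (a : A) (s : ℕ) : A := if s = 0 then a else x (Fin.ofNat (m + 1) (s - 1))
  have hy (a : A) (s : Fin (m + 1)) : y a (s + 1) = x s := by simp [y]
  have h1 (a : A) : P {ω | ∀ s ≤ m + 1, X s ω = y a s} =
      ENNReal.ofReal (μ (a, x 0) * pathWeight (trans μ) x) := by
    rw [hX.measure_path hpos, Finset.prod_range_succ', Finset.prod_range, pathWeight]
    have h0 : y a 0 = a := rfl
    have h1 : y a (0 + 1) = x 0 := hy a 0
    have h2 : ∏ i : Fin m, trans μ (y a (i + 1), y a (i + 1 + 1)) =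
        ∏ t : Fin m, trans μ (x t.castSucc, x t.succ) :=
      Finset.prod_congr rfl fun t _ => congrArg _ (Prod.ext (hy a t.castSucc) (hy a t.succ))
    rw [h0, h1, h2, mul_comm (∏ t, _), ← mul_assoc, marginal_mul_trans hμ.1.1 (a, x 0)]
  have h2 : {ω | (fun t : Fin (m + 1) => X (t + 1) ω) = x} =
      ⋃ a ∈ Finset.univ, {ω | ∀ s ≤ m + 1, X s ω = y a s} := by
    ext ω
    simp only [Set.mem_ofPred_eq, Set.mem_iUnion, Finset.mem_univ, exists_prop, true_and]
    refine ⟨fun h => ⟨X 0 ω, fun s hs => ?_⟩, fun ⟨a, h⟩ => funext fun t => ?_⟩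
    · rcases s with _ | s
      · rfl
      · exact (congrFun h ⟨s, by omega⟩).trans (hy (X 0 ω) ⟨s, by omega⟩).symm
    · exact (h (t + 1) (by omega)).trans (hy a t)
  rw [h2, measure_biUnion_finset]
  · simp_rw [h1]
    rw [← ENNReal.ofReal_sum_of_nonneg, ← Finset.sum_mul, ← hμ.2]
    · rfl
    · exact fun a _ => mul_nonneg (hpos _).le (pathWeight_nonneg (fun p => (hb p).le) x)
  · intro a _ b _ hab
    exact Set.disjoint_left.2 fun ω ha hb =>
      hab ((ha 0 (Nat.zero_le _)).symm.trans (hb 0 (Nat.zero_le _)))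
  · intro a _
    simp only [Set.ofPred_forall]
    exact .iInter fun s => .iInter fun _ => hX.measurable s (measurableSet_singleton _)

open Classical in
theorem IsStationaryMarkovChain.measure_empiricalFreq [DecidableEq A]
    (hX : IsStationaryMarkovChain P X μ) (hμ : μ ∈ stationaryDist A) (hpos : ∀ p, 0 < μ p)
    (V : Set (A → ℝ)) (m : ℕ) :
    P {ω | empiricalFreq (m + 1) (fun t => X t ω) ∈ V} = ENNReal.ofReal
      (∑ x : Fin (m + 1) → A with marginal (cyclicFreq x) ∈ V, pathProb μ x) := by
  rw [ENNReal.ofReal_sum_of_nonneg fun x _ => pathProb_nonneg hμ.1.1 x]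
  simp_rw [← hX.measure_path_succ hμ hpos]
  rw [← measure_biUnion_finset]
  · congr 1
    ext ω
    simp [empiricalFreq_eq_marginal]
  · intro x _ y _ hxy
    exact Set.disjoint_left.2 fun ω hx hy => hxy (Eq.trans (Eq.symm hx) hy)
  · intro x _
    have : Measurable fun ω => fun t : Fin (m + 1) => X (t + 1) ω :=
      measurable_pi_lambda _ fun t => hX.measurable _
    exact this (measurableSet_singleton x)

end Chain

/-! ### Exponential rates from non-asymptotic bounds -/

section Rates

open Topology

theorem limsup_log_div_le {u : ℕ → ℝ≥0∞} {C a : ℝ} {k : ℕ} (hC : 0 < C)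
    (h : ∀ m, u (m + 1) ≤
      ENNReal.ofReal (C * ((m + 2 : ℕ) : ℝ) ^ k * Real.exp (-((m + 1 : ℕ) * a)))) :
    limsup (fun l : ℕ => ENNReal.log (u l) / l) atTop ≤ ((-a : ℝ) : EReal) := by
  rw [← limsup_nat_add _ 1]
  let r (m : ℕ) : ℝ :=
    Real.log C / ((m + 1 : ℕ) : ℝ) + k * (Real.log (m + 2 : ℕ) / ((m + 1 : ℕ) : ℝ)) - a
  have hr : Tendsto r atTop (𝓝 (-a)) := by
    have h1 : Tendsto (fun m : ℕ => Real.log C / ((m + 1 : ℕ) : ℝ)) atTop (𝓝 0) :=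
      tendsto_const_nhds.div_atTop (tendsto_natCast_atTop_atTop.comp (tendsto_add_atTop_nat 1))
    have h2 : Tendsto (fun m : ℕ => Real.log (m + 2 : ℕ) / ((m + 1 : ℕ) : ℝ)) atTop (𝓝 0) := by
      -- This is `log n / (n - 1) → 0` at `n = m + 2`.
      refine ((Real.tendsto_pow_log_div_mul_add_atTop 1 (-1) 1 one_ne_zero).comp
        (tendsto_natCast_atTop_atTop.comp (tendsto_add_atTop_nat 2))).congr fun m => ?_
      simp only [Function.comp_apply, pow_one]
      congr 1
      push_cast
      ring
    have h3 := (h1.add (h2.const_mul (k : ℝ))).sub_const a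
    rwa [mul_zero, add_zero, zero_sub] at h3
  rw [← ((continuous_coe_real_ereal.tendsto _).comp hr).limsup_eq]
  refine limsup_le_limsup (.of_forall fun m => ?_)
  have hl : (0 : ℝ) < (m + 1 : ℕ) := by positivity
  have hl2 : (0 : ℝ) < (m + 2 : ℕ) := by positivity
  refine (EReal.div_le_div_right_of_nonneg (by positivity) (ENNReal.log_monotone (h m))).trans_eq ?_
  rw [ENNReal.log_ofReal_of_pos (by positivity), Real.log_mul (by positivity) (by positivity),
    Real.log_mul hC.ne' (by positivity), Real.log_exp, Real.log_pow, ← EReal.coe_coe_eq_natCast,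
    ← EReal.coe_div]
  simp only [Function.comp_apply, r]
  congr 1
  field_simp
  ring

theorem le_liminf_log_div {u : ℕ → ℝ≥0∞} {c a : ℝ} (hc : 0 < c)
    (h : ∀ᶠ m : ℕ in atTop, ENNReal.ofReal (c * Real.exp (-((m + 1 : ℕ) * a))) ≤ u (m + 1)) :
    ((-a : ℝ) : EReal) ≤ liminf (fun l : ℕ => ENNReal.log (u l) / l) atTop := by
  rw [← liminf_nat_add _ 1]
  have hr : Tendsto (fun m : ℕ => Real.log c / ((m + 1 : ℕ) : ℝ) - a) atTop (𝓝 (-a)) := by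
    have h1 : Tendsto (fun m : ℕ => Real.log c / ((m + 1 : ℕ) : ℝ)) atTop (𝓝 0) :=
      tendsto_const_nhds.div_atTop (tendsto_natCast_atTop_atTop.comp (tendsto_add_atTop_nat 1))
    simpa using h1.sub_const a
  rw [← ((continuous_coe_real_ereal.tendsto _).comp hr).liminf_eq]
  refine liminf_le_liminf (h.mono fun m hm => ?_)
  have hl : (0 : ℝ) < (m + 1 : ℕ) := by positivity
  refine le_trans (Eq.le ?_)
    (EReal.div_le_div_right_of_nonneg (by positivity) (ENNReal.log_monotone hm))
  rw [ENNReal.log_ofReal_of_pos (by positivity), Real.log_mul (by positivity) (by positivity),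
    Real.log_exp, ← EReal.coe_coe_eq_natCast, ← EReal.coe_div]
  simp only [Function.comp_apply]
  congr 1
  field_simp
  ring

end Rates

/-! ### Law of large numbers and change of measure -/

section LowerBound

open Topology

variable {A : Type*} [Fintype A]

theorem exists_pos_le_condKL {ρ : A × A → ℝ} (hρ : ρ ∈ stationaryDist A) (hpos : ∀ p, 0 < ρ p)
    {U : Set (A × A → ℝ)} (hU : IsOpen U) (hρU : ρ ∈ U) :
    ∃ a > 0, ∀ ν ∈ stationaryDist A, ν ∉ U → a ≤ condKL ν ρ := by
  have hK : IsCompact (stationaryDist A \ U) := isCompact_stationaryDist.diff hU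
  rcases (stationaryDist A \ U).eq_empty_or_nonempty with h0 | hne
  · exact ⟨1, one_pos, fun ν hν hνU => absurd (h0.subset ⟨hν, hνU⟩) (Set.notMem_empty _)⟩
  obtain ⟨ν, hν, hmin⟩ := hK.exists_isMinOn hne
    ((continuousOn_condKL ρ).mono fun ν hν => hν.1.1.1)
  refine ⟨condKL ν ρ, (condKL_nonneg hν.1 hpos).lt_of_ne fun h => hν.2 ?_,
    fun ν' h1 h2 => hmin ⟨h1, h2⟩⟩
  rwa [eq_of_condKL_eq_zero hν.1 hρ hpos h.symm]

/-- Strictly positive stationary distributions approximate all of them. -/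
theorem exists_pos_condKL_lt {ν μ : A × A → ℝ} (hν : ν ∈ stationaryDist A)
    (hμ : μ ∈ stationaryDist A) (hpos : ∀ p, 0 < μ p) {V : Set (A → ℝ)} (hV : IsOpen V)
    (hνV : marginal ν ∈ V) {z : ℝ} (hz : condKL ν μ < z) :
    ∃ ρ ∈ stationaryDist A, (∀ p, 0 < ρ p) ∧ marginal ρ ∈ V ∧ condKL ρ μ < z := by
  let f (ε : ℝ) (p : A × A) : ℝ := (1 - ε) * ν p + ε * μ p
  have hf : Continuous f := by fun_prop
  have hf0 : f 0 = ν := by ext p; simp [f]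
  have hlt : ∀ᶠ ε : ℝ in 𝓝[>] 0, ε < 1 := nhdsWithin_le_nhds (gt_mem_nhds one_pos)
  have hgt : ∀ᶠ ε : ℝ in 𝓝[>] 0, 0 < ε := self_mem_nhdsWithin
  have hp {ε : ℝ} (h1 : ε < 1) (h0 : 0 < ε) (p : A × A) : 0 < f ε p :=
    add_pos_of_nonneg_of_pos (mul_nonneg (sub_pos.2 h1).le (hν.1.1 p)) (mul_pos h0 (hpos p))
  -- The limit is taken within the nonnegative orthant, where `continuousOn_condKL` applies.
  have ht : Tendsto f (𝓝[>] 0) (𝓝[{ν | ∀ p, 0 ≤ ν p}] ν) := by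
    refine tendsto_nhdsWithin_iff.2 ⟨?_, ?_⟩
    · have := hf.tendsto 0
      rw [hf0] at this
      exact this.mono_left nhdsWithin_le_nhds
    · filter_upwards [hlt, hgt] with ε h1 h0 p using (hp h1 h0 p).le
  have e1 := ht.eventually ((continuousOn_condKL μ ν hν.1.1).eventually (gt_mem_nhds hz))
  have e2 := ht.eventually (nhdsWithin_le_nhds
    ((hV.preimage continuous_marginal).mem_nhds hνV))
  obtain ⟨ε, h1, h0, hz, hV⟩ := (hlt.and (hgt.and (e1.and e2))).exists
  refine ⟨f ε, ⟨⟨fun p => (hp h1 h0 p).le, ?_⟩, fun i => ?_⟩, hp h1 h0, hV, hz⟩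
  · simp only [f, Finset.sum_add_distrib, ← Finset.mul_sum, hν.1.2, hμ.1.2]
    ring
  · simp only [f, Finset.sum_add_distrib, ← Finset.mul_sum, hν.2 i, hμ.2 i]

variable [DecidableEq A]

open Classical in
/-- Weak law of large numbers for the cyclic doublet frequencies. -/
theorem eventually_half_le_sum_pathProb {ρ : A × A → ℝ} (hρ : ρ ∈ stationaryDist A)
    (hpos : ∀ p, 0 < ρ p) {U : Set (A × A → ℝ)} (hU : IsOpen U) (hρU : ρ ∈ U) :
    ∀ᶠ m : ℕ in atTop,
      1 / 2 ≤ ∑ x : Fin (m + 1) → A with cyclicFreq x ∈ U, pathProb ρ x := by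
  obtain ⟨a, ha, hle⟩ := exists_pos_le_condKL hρ hpos hU hρU
  obtain ⟨C, hC, hsum⟩ := exists_sum_pathProb_le hρ hpos
  have hlim : Tendsto (fun m : ℕ => C * ((m + 2 : ℕ) : ℝ) ^ Fintype.card (A × A) *
      Real.exp (-((m + 1 : ℕ) * a))) atTop (𝓝 0) := by
    -- This is `n ^ k r ^ n → 0` with `n = m + 2` and `r = exp (-a)`; the factor `exp a` corrects
    -- the exponent to `m + 1`.
    have h1 := ((tendsto_add_atTop_iff_nat 2).2 (tendsto_pow_const_mul_const_pow_of_abs_lt_one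
      (Fintype.card (A × A)) (r := Real.exp (-a)) (by
        rw [abs_of_pos (Real.exp_pos _), Real.exp_lt_one_iff]
        linarith))).const_mul (C * Real.exp a)
    rw [mul_zero] at h1
    refine h1.congr fun m => ?_
    have h2 : Real.exp a * Real.exp (-a) ^ (m + 2) = Real.exp (-((m + 1 : ℕ) * a)) := by
      rw [← Real.exp_nat_mul, ← Real.exp_add]
      congr 1
      push_cast
      ring
    rw [← h2]
    ring
  filter_upwards [hlim.eventually (gt_mem_nhds (show (0 : ℝ) < 1 / 2 by norm_num))] with m hm
  have h1 := hsum (Finset.univ.filter fun x : Fin (m + 1) → A => ¬ cyclicFreq x ∈ U) a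
    fun x hx => hle _ (cyclicFreq_mem x) (Finset.mem_filter.1 hx).2
  have h2 := Finset.sum_filter_add_sum_filter_not Finset.univ
    (fun x : Fin (m + 1) → A => cyclicFreq x ∈ U) (pathProb ρ)
  rw [sum_pathProb hρ hpos] at h2
  linarith

-- Change of measure: for types near `ρ` the normalized log-likelihood ratio of `ρ` to `μ` stays
-- below `z`, and such types carry at least half of the mass of the `ρ`-chain.
open Classical in
theorem exists_eventually_le_sum_pathProb {ν μ : A × A → ℝ} (hν : ν ∈ stationaryDist A)
    (hμ : μ ∈ stationaryDist A) (hpos : ∀ p, 0 < μ p) {V : Set (A → ℝ)} (hV : IsOpen V)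
    (hνV : marginal ν ∈ V) {z : ℝ} (hz : condKL ν μ < z) :
    ∃ c > 0, ∀ᶠ m : ℕ in atTop, c * Real.exp (-((m + 1 : ℕ) * z)) ≤
      ∑ x : Fin (m + 1) → A with marginal (cyclicFreq x) ∈ V, pathProb μ x := by
  obtain ⟨ρ, hρ, hρpos, hρV, hρz⟩ := exists_pos_condKL_lt hν hμ hpos hV hνV hz
  obtain ⟨c, hc, hcμ⟩ := exists_pathProb_bounds hμ hpos
  obtain ⟨d, hd, hdρ⟩ := exists_pathProb_bounds hρ hρpos
  -- With the logarithms frozen at `ρ`, the ratio is linear in the type and equals `condKL ρ μ < z`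
  -- at `ρ`.
  obtain ⟨U, hU, hρU, hUV⟩ : ∃ U : Set (A × A → ℝ), IsOpen U ∧ ρ ∈ U ∧ ∀ ν ∈ U,
      marginal ν ∈ V ∧ ∑ p, ν p * (Real.log (trans ρ p) - Real.log (trans μ p)) < z :=
    ⟨_, (hV.preimage continuous_marginal).inter
      (isOpen_lt (f := fun ν : A × A → ℝ => ∑ p, ν p * (Real.log (trans ρ p) - Real.log (trans μ p)))
        (by fun_prop) (continuous_const (y := z))), ⟨hρV, hρz⟩, fun _ h => h⟩
  refine ⟨c * d * (1 / 2), by positivity, ?_⟩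
  filter_upwards [eventually_half_le_sum_pathProb hρ hρpos hU hρU] with m hm
  calc c * d * (1 / 2) * Real.exp (-((m + 1 : ℕ) * z))
      = c * d * Real.exp (-((m + 1 : ℕ) * z)) * (1 / 2) := by ring
    _ ≤ c * d * Real.exp (-((m + 1 : ℕ) * z)) *
        ∑ x : Fin (m + 1) → A with cyclicFreq x ∈ U, pathProb ρ x := by gcongr
    _ ≤ ∑ x : Fin (m + 1) → A with cyclicFreq x ∈ U, pathProb μ x := by
        rw [Finset.mul_sum]
        refine Finset.sum_le_sum fun x hx => ?_
        have hxz := (hUV _ (Finset.mem_filter.1 hx).2).2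
        simp only [mul_sub, Finset.sum_sub_distrib] at hxz
        have h1 := mul_le_mul_of_nonneg_left hxz.le (Nat.cast_nonneg (α := ℝ) (m + 1))
        calc c * d * Real.exp (-((m + 1 : ℕ) * z)) * pathProb ρ x
            ≤ c * d * Real.exp (-((m + 1 : ℕ) * z)) * (d⁻¹ * Real.exp (((m + 1 : ℕ) : ℝ) *
                ∑ p, cyclicFreq x p * Real.log (trans ρ p))) := by
              gcongr
              exact (hdρ x).2
          _ = c * Real.exp (-((m + 1 : ℕ) * z) + ((m + 1 : ℕ) : ℝ) *
                ∑ p, cyclicFreq x p * Real.log (trans ρ p)) := by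
              rw [Real.exp_add]
              field_simp
          _ ≤ c * Real.exp (((m + 1 : ℕ) : ℝ) *
                ∑ p, cyclicFreq x p * Real.log (trans μ p)) := by
              gcongr
              linarith
          _ ≤ pathProb μ x := (hcμ x).1
    _ ≤ _ := Finset.sum_le_sum_of_subset_of_nonneg
        (Finset.monotone_filter_right _ fun x _ hx => (hUV _ hx).1) fun x _ _ => pathProb_nonneg hμ.1.1 x

end LowerBound

/-! ### The rate function: attainment and lower semicontinuity -/

section RateFunction

variable {A : Type*} [Fintype A]

/-- The feasible set is compact and contains the product `φ ⊗ φ`, so the infimum is attained and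
finite. -/
theorem exists_singletonRate_eq {μ : A × A → ℝ} (hpos : ∀ p, 0 < μ p) (φ : stdSimplex ℝ A) :
    ∃ ν ∈ stationaryDist A, marginal ν = φ ∧ singletonRate μ φ = condKL ν μ := by
  have hK : IsCompact (stationaryDist A ∩ marginal ⁻¹' {(φ : A → ℝ)}) :=
    isCompact_stationaryDist.inter_right (isClosed_singleton.preimage continuous_marginal)
  have hm : marginal (fun p : A × A => (φ : A → ℝ) p.1 * (φ : A → ℝ) p.2) = φ := by
    ext i
    simp only [marginal, ← Finset.mul_sum]
    exact (congrArg _ φ.2.2).trans (mul_one _)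
  have hne : (stationaryDist A ∩ marginal ⁻¹' {(φ : A → ℝ)}).Nonempty := by
    refine ⟨fun p => (φ : A → ℝ) p.1 * (φ : A → ℝ) p.2,
      ⟨⟨fun p => mul_nonneg (φ.2.1 _) (φ.2.1 _), ?_⟩, fun i => ?_⟩, hm⟩
    · rw [← sum_marginal, hm]
      exact φ.2.2
    · simp only [mul_comm]
  obtain ⟨ν, hν, hmin⟩ := hK.exists_isMinOn hne
    ((continuousOn_condKL μ).mono fun ν hν => hν.1.1.1)
  refine ⟨ν, hν.1, hν.2, le_antisymm ?_ ?_⟩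
  · rw [← condRelEntropy_eq_condKL hν.1.1.1 hpos]
    exact iInf₂_le ν ⟨hν.1, hν.2⟩
  · refine le_iInf₂ fun ν' hν' => ?_
    rw [condRelEntropy_eq_condKL hν'.1.1.1 hpos]
    exact EReal.coe_le_coe_iff.2 (hmin hν')

theorem singletonRate_marginal_le {μ ν : A × A → ℝ} (hpos : ∀ p, 0 < μ p)
    (hν : ν ∈ stationaryDist A) {φ : stdSimplex ℝ A} (h : marginal ν = φ) :
    singletonRate μ φ ≤ condKL ν μ := by
  rw [← condRelEntropy_eq_condKL hν.1.1 hpos]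
  exact iInf₂_le ν ⟨hν, h⟩

/-- By attainment, each sublevel set of the rate is the image under `marginal` of a compact sublevel
set of `condKL`. -/
theorem lowerSemicontinuous_singletonRate {μ : A × A → ℝ} (hpos : ∀ p, 0 < μ p) :
    LowerSemicontinuous (singletonRate μ) := by
  rw [lowerSemicontinuous_iff_isClosed_preimage]
  intro y
  have hcont : ContinuousOn (fun ν => (condKL ν μ : EReal)) (stationaryDist A) :=
    continuous_coe_real_ereal.comp_continuousOn
      ((continuousOn_condKL μ).mono fun ν hν => hν.1.1)
  have hK : IsCompact (stationaryDist A ∩ (fun ν => (condKL ν μ : EReal)) ⁻¹' Set.Iic y) :=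
    isCompact_stationaryDist.of_isClosed_subset
      (hcont.preimage_isClosed_of_isClosed isCompact_stationaryDist.isClosed isClosed_Iic)
      Set.inter_subset_left
  convert (hK.image continuous_marginal).isClosed.preimage continuous_subtype_val using 1
  ext φ
  constructor
  · intro h
    obtain ⟨ν, hν, hm, hJ⟩ := exists_singletonRate_eq hpos φ
    exact ⟨ν, ⟨hν, hJ.ge.trans h⟩, hm⟩
  · rintro ⟨ν, ⟨hν, hy⟩, hm⟩
    exact (singletonRate_marginal_le hpos hν hm).trans hy

end RateFunction

/-! ### The large deviation property -/

theorem IsStationaryMarkovChain.hasLDP {Ω A : Type*} [MeasurableSpace Ω] [Fintype A]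
    [DecidableEq A] [MeasurableSpace A] [MeasurableSingletonClass A] {P : Measure Ω}
    {X : ℕ → Ω → A} {μ : A × A → ℝ} (hX : IsStationaryMarkovChain P X μ)
    (hμ : μ ∈ stationaryDist A) (hpos : ∀ p, 0 < μ p) :
    HasLDP P (stdSimplex ℝ A) (fun l ω => empiricalFreq l (fun t => X t ω))
      (singletonRate μ) := by
  classical
  refine ⟨fun φ => ?_, fun Γ hΓ => ?_, fun Γ _ => ?_⟩
  · obtain ⟨ν, -, -, h⟩ := exists_singletonRate_eq hpos φ
    rw [h]
    exact EReal.coe_ne_bot _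
  · obtain ⟨V, hV, rfl⟩ := isOpen_induced_iff.1 hΓ
    refine EReal.neg_le_of_neg_le (le_iInf₂ fun φ hφ => le_iInf₂ fun ν ⟨hν, hm⟩ => ?_)
    rw [condRelEntropy_eq_condKL hν.1.1 hpos]
    refine EReal.le_of_forall_lt_iff_le.1 fun z hz => EReal.neg_le_of_neg_le ?_
    obtain ⟨c, hc, hev⟩ := exists_eventually_le_sum_pathProb hν hμ hpos hV
      (show marginal ν ∈ V by rw [hm]; exact hφ) (EReal.coe_lt_coe_iff.1 hz)
    rw [← EReal.coe_neg]
    refine le_liminf_log_div hc (hev.mono fun m hle => ?_)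
    rw [hX.measure_empiricalFreq hμ hpos]
    refine ENNReal.ofReal_le_ofReal (hle.trans_eq (Finset.sum_congr ?_ fun _ _ => rfl))
    ext x
    have := marginal_mem_stdSimplex (cyclicFreq_mem x)
    simp [this]
  · obtain ⟨C, hC, hsum⟩ := exists_sum_pathProb_le hμ hpos
    -- Real `z` below the infimum also cover the value `⊤`. Every word in the event has a type `ν`
    -- with `z ≤ J(ν̄) ≤ D_c(ν ‖ μ)`.
    refine EReal.le_neg_of_le_neg (EReal.ge_of_forall_gt_iff_ge.1 fun z hz =>
      EReal.le_neg_of_le_neg ?_)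
    rw [← EReal.coe_neg]
    refine limsup_log_div_le (k := Fintype.card (A × A)) hC fun m => ?_
    rw [hX.measure_empiricalFreq hμ hpos]
    refine ENNReal.ofReal_le_ofReal (hsum _ _ fun x hx => ?_)
    obtain ⟨φ, hφ, hm⟩ := (Finset.mem_filter.1 hx).2
    exact EReal.coe_le_coe_iff.1 ((hz.le.trans (iInf₂_le φ hφ)).trans
      (singletonRate_marginal_le hpos (cyclicFreq_mem x) hm.symm))

end MarkovLDP

theorem mainTheorem4 {Ω A : Type*} [MeasurableSpace Ω] [Fintype A] [DecidableEq A]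
    [MeasurableSpace A] [MeasurableSingletonClass A]
    (P : Measure Ω) [IsProbabilityMeasure P] (X : ℕ → Ω → A)
    (μ : A × A → ℝ) (hμ : μ ∈ MarkovLDP.stationaryDist A)
    (hX : MarkovLDP.IsStationaryMarkovChain P X μ) (hpos : ∀ i j, 0 < μ (i, j)) :
    MarkovLDP.HasLDP P (stdSimplex ℝ A)
        (fun l ω => MarkovLDP.empiricalFreq l (fun t => X t ω)) (MarkovLDP.singletonRate μ) ∧
      LowerSemicontinuous (MarkovLDP.singletonRate μ) :=
  ⟨hX.hasLDP hμ fun p => hpos p.1 p.2,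
    MarkovLDP.lowerSemicontinuous_singletonRate fun p => hpos p.1 p.2⟩
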